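/- Let $X$ be a real random variable with mean $\mu$, central moments $\mu_j=\mathbb{E}(X-\mu)^j$ and variance $\sigma^2=\mu_2$. For independent copies $X_1,X_2,\dots$ of $X$ put $\bar X_n=\frac1n\sum_{i=1}^n X_i$ and $M_{k,n}=\frac1n\sum_{i=1}^n (X_i-\bar X_n)^k$. Let $k\ge 2$. The distribution of $X$ is called singular of order $k$ if $X$ is non-degenerate (its distribution is not concentrated at one point), $\mathbb{E}|X|^{2k}<\infty$, and $\sqrt n\,(M_{k,n}-\mu_k)\to 0$ in probability as $n\to\infty$. Suppose that the distribution of $X$ is singular of order $k\ge 2$, and let $\chi_1^2$ and $\tilde\chi_1^2$ be independent random variables, each having the chi-square distribution with one degree of freedom. Then there exists a constant $\lambda_k\in\mathbb{R}$ such that $$n(\mu_k-M_{k,n})\xrightarrow{\ d\ }\lambda_k\chi_1^2\qquad(n\to\infty)$$ if and only if $$\mu_k^2=\sigma^2\left(\mu_{2k-2}-\mu_{k-1}^2\right).\tag{1}$$ If (1) holds, then the convergence takes place for exactly one constant, namely $\lambda_k=k\left(\mu_k-\tfrac12(k-1)\sigma^2\mu_{k-2}\right)$. If (1) does not hold, then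 $$n(\mu_k-M_{k,n})\xrightarrow{\ d\ }\lambda_k\chi_1^2-\tilde\lambda_k\tilde\chi_1^2$$ with $$\lambda_k=\tfrac k2\left(\sigma\sqrt{\theta_k}+\alpha_k\right)>0,\qquad \tilde\lambda_k=\tfrac k2\left(\sigma\sqrt{\theta_k}-\alpha_k\right)>0,$$ where $$\alpha_k=\mu_k-\tfrac12(k-1)\sigma^2\mu_{k-2},\qquad \theta_k=\mu_{2k-2}-\mu_{k-1}^2-(k-1)\mu_{k-2}\left[\mu_k-\tfrac14(k-1)\sigma^2\mu_{k-2}\right].$$ -/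

import Mathlib

open MeasureTheory ProbabilityTheory Filter Finset
open scoped Topology

noncomputable section

namespace SampleMoments

/-- The sample mean of the first `n` observations `x 0, …, x (n - 1)`. -/
def sampleMean (n : ℕ) (x : ℕ → ℝ) : ℝ :=
  (∑ i ∈ range n, x i) / n

/-- The sample central moment of order `k` of the first `n` observations. -/
def sampleCentralMoment (k n : ℕ) (x : ℕ → ℝ) : ℝ :=
  (∑ i ∈ range n, (x i - sampleMean n x) ^ k) / n

/-- The `j`-th central moment of the distribution `F` on `ℝ`. -/
def mom (F : Measure ℝ) (j : ℕ) : ℝ :=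
  centralMoment id j F

/-- The standard deviation of the distribution `F` on `ℝ`. -/
def stdDev (F : Measure ℝ) : ℝ :=
  Real.sqrt (mom F 2)

/-- `F` is singular of order `k`: it is non-degenerate (it has at least two points of increase),
its absolute moment of order `2k` is finite, and for independent observations from `F` the
quantity `√n (M_{k,n} - μ_k)` tends to `0` in probability. The observations are the coordinates of
the infinite product of copies of `F`. -/
structure IsSingular (F : Measure ℝ) (k : ℕ) : Prop where
  nondegenerate : F.support.Nontrivial
  integrable : Integrable (fun x : ℝ => |x| ^ (2 * k)) F
  tendsto : TendstoInMeasure (Measure.infinitePi (fun _ : ℕ => F))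
    (fun (n : ℕ) (x : ℕ → ℝ) => Real.sqrt n * (sampleCentralMoment k n x - mom F k))
    atTop (fun _ => 0)

/-- The chi-square distribution with one degree of freedom: the law of the square of a standard
normal random variable. -/
def chiSquareOne : Measure ℝ :=
  (gaussianReal 0 1).map (fun z => z ^ 2)

/-- The constant `α_k = μ_k - (k-1) σ² μ_{k-2} / 2`, for `k ≥ 2`. -/
def alpha (F : Measure ℝ) (k : ℕ) : ℝ :=
  mom F k - 1 / 2 * ((k : ℝ) - 1) * stdDev F ^ 2 * mom F (k - 2)

/-- The constant
`θ_k = μ_{2k-2} - μ_{k-1}² - (k-1) μ_{k-2} (μ_k - (k-1) σ² μ_{k-2} / 4)`, for `k ≥ 2`. -/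
def theta (F : Measure ℝ) (k : ℕ) : ℝ :=
  mom F (2 * k - 2) - mom F (k - 1) ^ 2
    - ((k : ℝ) - 1) * mom F (k - 2)
      * (mom F k - 1 / 4 * ((k : ℝ) - 1) * stdDev F ^ 2 * mom F (k - 2))

/-- The coefficient `(k / 2) (σ √θ_k + α_k)`. -/
def lambdaPos (F : Measure ℝ) (k : ℕ) : ℝ :=
  (k : ℝ) / 2 * (stdDev F * Real.sqrt (theta F k) + alpha F k)

/-- The coefficient `(k / 2) (σ √θ_k - α_k)`. -/
def lambdaNeg (F : Measure ℝ) (k : ℕ) : ℝ :=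
  (k : ℝ) / 2 * (stdDev F * Real.sqrt (theta F k) - alpha F k)

/-- The random variables `n (μ_k - M_{k,n})`, computed from the observations `X 0, X 1, …`. -/
def scaledError {Ω : Type*} (F : Measure ℝ) (k : ℕ) (X : ℕ → Ω → ℝ) (n : ℕ) (ω : Ω) : ℝ :=
  (n : ℝ) * (mom F k - sampleCentralMoment k n (fun i => X i ω))

/-- The relation `μ_k² = σ² (μ_{2k-2} - μ_{k-1}²)`, for `k ≥ 2`. -/
def SingleChiRelation (F : Measure ℝ) (k : ℕ) : Prop :=
  mom F k ^ 2 = stdDev F ^ 2 * (mom F (2 * k - 2) - mom F (k - 1) ^ 2)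

end SampleMoments

end

/-! Write Y = X - μ, and let S be the Gaussian limit of the normalized sums of Y. Expanding M_{k,n}
binomially about μ gives √n(M_{k,n} - μ_k) as the normalized sum of D = Y^k - μ_k - kμ_{k-1}Y plus
terms tending to 0 in probability. By the CLT the limit is centred Gaussian with variance E D², so
singularity forces D = 0 almost surely (`IsSingular.ae_defect_eq_zero`).

Once D vanishes, the next order of the expansion governs n(μ_k - M_{k,n}). Its limit is kST - (k
choose 2)μ_{k-2}S², with T the limit for Y^{k-1} - μ_{k-1}. This equals kSV, where V is the limit
for the `cofactor`. The pair (S, V) is centred Gaussian with variances σ², θ_k and covariance α_k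
(`IsSingular.tendstoInDistribution_scaledError`).

Relation (1) is equivalent to α_k² = σ²θ_k, equality in Cauchy–Schwarz (`singleChiRelation_iff`). In
that case V is a multiple of S and the limit is a multiple of one χ². Otherwise, in suitable
coordinates SV is a difference of squares with both coefficients positive; comparing mean and
variance shows that this is never a multiple of one χ² (`map_mul_ne_map_mul_sub_mul`). -/

namespace SampleMoments

/-! ### Gaussian laws and convergence in distribution in the plane. -/

/-- The standard Gaussian measure on the plane. -/
noncomputable abbrev gaussianPlane : Measure (ℝ × ℝ) :=
  (gaussianReal 0 1).prod (gaussianReal 0 1)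

/-- The normalized sum `n ^ (-1/2) * ∑ i < n, f (X i)`. -/
noncomputable def normSum {Ω : Type*} (X : ℕ → Ω → ℝ) (f : ℝ → ℝ) (n : ℕ) (ω : Ω) : ℝ :=
  (√(n : ℝ))⁻¹ * ∑ i ∈ range n, f (X i ω)

lemma map_linear_gaussianPlane (a b : ℝ) :
    gaussianPlane.map (fun z => a * z.1 + b * z.2) = gaussianReal 0 (a ^ 2 + b ^ 2).toNNReal := by
  have h1 : HasLaw (fun z : ℝ × ℝ => z.1) (gaussianReal 0 1) gaussianPlane := ⟨by fun_prop, by simp⟩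
  have h2 : HasLaw (fun z : ℝ × ℝ => z.2) (gaussianReal 0 1) gaussianPlane := ⟨by fun_prop, by simp⟩
  have hind : IndepFun (fun z : ℝ × ℝ => a * z.1) (fun z : ℝ × ℝ => b * z.2) gaussianPlane :=
    indepFun_prod (X := fun x : ℝ => a * x) (Y := fun x : ℝ => b * x) (by fun_prop) (by fun_prop)
  have := gaussianReal_add_gaussianReal_of_indepFun hind (gaussianReal_const_mul h1 a).map_eq
    (gaussianReal_const_mul h2 b).map_eq
  have e : (fun z : ℝ × ℝ => a * z.1 + b * z.2)
      = (fun z : ℝ × ℝ => a * z.1) + (fun z : ℝ × ℝ => b * z.2) := rfl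
  rw [e, this]
  congr 1
  · simp
  · ext
    simp only [mul_one, NNReal.coe_add, NNReal.coe_mk]
    rw [Real.coe_toNNReal _ (by positivity)]

/-- Only the law of the limit matters; this carries limits built on `gaussianPlane` over to the
space where `C` and `C'` live. -/
lemma TendstoInDistribution.congr_map {Ω Ω₁ Ω₂ E : Type*} [MeasurableSpace Ω]
    [MeasurableSpace Ω₁] [MeasurableSpace Ω₂] {P : Measure Ω} [IsProbabilityMeasure P]
    {P₁ : Measure Ω₁} [IsProbabilityMeasure P₁] {P₂ : Measure Ω₂} [IsProbabilityMeasure P₂]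
    [TopologicalSpace E] [MeasurableSpace E] [OpensMeasurableSpace E]
    {S : ℕ → Ω → E} {Z : Ω₁ → E} {W : Ω₂ → E}
    (h : TendstoInDistribution S atTop Z (fun _ => P) P₁) (hW : AEMeasurable W P₂)
    (hZW : P₁.map Z = P₂.map W) : TendstoInDistribution S atTop W (fun _ => P) P₂ where
  forall_aemeasurable := h.forall_aemeasurable
  aemeasurable_limit := hW
  tendsto := by
    have e : (⟨P₁.map Z, Measure.isProbabilityMeasure_map h.aemeasurable_limit⟩ :
        ProbabilityMeasure E) = ⟨P₂.map W, Measure.isProbabilityMeasure_map hW⟩ := Subtype.ext hZW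
    rw [← e]
    exact h.tendsto

/-- Frequency 1 is enough for Cramér–Wold, since the coefficients of the linear combination play the
role of the frequency. -/
lemma integral_cexp_mul_tendsto {Ω Ω' : Type*} [MeasurableSpace Ω] [MeasurableSpace Ω']
    {P : Measure Ω} [IsProbabilityMeasure P] {P' : Measure Ω'} [IsProbabilityMeasure P']
    {S : ℕ → Ω → ℝ} {Z : Ω' → ℝ} (h : TendstoInDistribution S atTop Z (fun _ => P) P') :
    Tendsto (fun n => ∫ ω, Complex.exp (S n ω * Complex.I) ∂P) atTop
      (𝓝 (∫ ω, Complex.exp (Z ω * Complex.I) ∂P')) := by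
  have := ProbabilityMeasure.tendsto_iff_tendsto_charFun.1 h.tendsto 1
  simp only [ProbabilityMeasure.coe_mk, charFun_apply_real] at this
  rw [integral_map h.aemeasurable_limit (by fun_prop)] at this
  simp_rw [integral_map (h.forall_aemeasurable _) (by fun_prop : AEStronglyMeasurable
    (fun x : ℝ => Complex.exp (((1 : ℝ) : ℂ) * x * Complex.I)) _)] at this
  simpa using this

/-- The Cramér–Wold device in the plane. -/
lemma tendstoInDistribution_prodMk_of_linear {Ω Ω' : Type*} [MeasurableSpace Ω]
    [MeasurableSpace Ω'] {P : Measure Ω} [IsProbabilityMeasure P] {P' : Measure Ω'}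
    [IsProbabilityMeasure P'] {S T : ℕ → Ω → ℝ} {Z W : Ω' → ℝ}
    (hS : ∀ n, AEMeasurable (S n) P) (hT : ∀ n, AEMeasurable (T n) P)
    (hZ : AEMeasurable Z P') (hW : AEMeasurable W P')
    (h : ∀ s t : ℝ, TendstoInDistribution (fun n ω => s * S n ω + t * T n ω) atTop
      (fun ω => s * Z ω + t * W ω) (fun _ => P) P') :
    TendstoInDistribution (fun n ω => (S n ω, T n ω)) atTop (fun ω => (Z ω, W ω))
      (fun _ => P) P' := by
  -- Characteristic functions need an inner product, hence the passage to the Euclidean plane.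
  have hST : ∀ n, AEMeasurable (fun ω => WithLp.toLp 2 (S n ω, T n ω)) P := fun n =>
    (WithLp.measurable_toLp 2 (ℝ × ℝ)).comp_aemeasurable ((hS n).prodMk (hT n))
  have hZW : AEMeasurable (fun ω => WithLp.toLp 2 (Z ω, W ω)) P' :=
    (WithLp.measurable_toLp 2 (ℝ × ℝ)).comp_aemeasurable (hZ.prodMk hW)
  have key : TendstoInDistribution (fun n ω => WithLp.toLp 2 (S n ω, T n ω)) atTop
      (fun ω => WithLp.toLp 2 (Z ω, W ω)) (fun _ => P) P' := by
    refine ⟨hST, hZW, ProbabilityMeasure.tendsto_iff_tendsto_charFun.2 fun t => ?_⟩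
    simp only [ProbabilityMeasure.coe_mk, charFun_apply]
    rw [integral_map hZW (by fun_prop)]
    simp_rw [integral_map (hST _) (by fun_prop : AEStronglyMeasurable
      (fun x : WithLp 2 (ℝ × ℝ) => Complex.exp ((inner ℝ x t : ℝ) * Complex.I)) _)]
    simpa [WithLp.prod_inner_apply] using integral_cexp_mul_tendsto (h t.fst t.snd)
  exact key.continuous_comp (g := WithLp.ofLp) (by fun_prop)

/-! ### Central limit theorem and law of large numbers for functions of the observations. -/

section CLT

variable {Ω : Type*} [MeasurableSpace Ω] {P : Measure Ω} {F : Measure ℝ} {X : ℕ → Ω → ℝ}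

lemma aemeasurable_normSum (hX_law : ∀ i, HasLaw (X i) F P) {f : ℝ → ℝ} (hf : Measurable f)
    (n : ℕ) : AEMeasurable (normSum X f n) P :=
  .const_mul (Finset.aemeasurable_fun_sum _ fun i _ =>
    hf.comp_aemeasurable (hX_law i).aemeasurable) _

lemma identDistrib_comp (hX_law : ∀ i, HasLaw (X i) F P) {f : ℝ → ℝ} (hf : Measurable f)
    (i : ℕ) : IdentDistrib (fun ω => f (X i ω)) (fun ω => f (X 0 ω)) P P :=
  IdentDistrib.comp ⟨(hX_law i).aemeasurable, (hX_law 0).aemeasurable,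
    (hX_law i).map_eq.trans (hX_law 0).map_eq.symm⟩ hf

variable [IsProbabilityMeasure P]

lemma tendstoInDistribution_normSum (hX_law : ∀ i, HasLaw (X i) F P) (hX_indep : iIndepFun X P)
    {f : ℝ → ℝ} (hf : Measurable f) (hf2 : MemLp f 2 F) (hf0 : ∫ x, f x ∂F = 0)
    {Ω' : Type*} [MeasurableSpace Ω'] {P' : Measure Ω'} [IsProbabilityMeasure P'] {Y : Ω' → ℝ}
    (hY : HasLaw Y (gaussianReal 0 (∫ x, f x ^ 2 ∂F).toNNReal) P') :
    TendstoInDistribution (normSum X f) atTop Y (fun _ => P) P' := by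
  have h0 : ∫ ω, f (X 0 ω) ∂P = 0 := by
    rw [← hf0]; exact (hX_law 0).integral_comp hf.aestronglyMeasurable
  have hv : Var[fun ω => f (X 0 ω); P] = ∫ x, f x ^ 2 ∂F := by
    rw [variance_of_integral_eq_zero (X := fun ω => f (X 0 ω))
      (hf.comp_aemeasurable (hX_law 0).aemeasurable) h0]
    exact (hX_law 0).integral_comp (f := fun x => f x ^ 2) (hf.pow_const 2).aestronglyMeasurable
  have hm : MemLp (fun ω => f (X 0 ω)) 2 P := by
    rw [← (hX_law 0).map_eq] at hf2
    exact (memLp_map_measure_iff hf.aestronglyMeasurable (hX_law 0).aemeasurable).1 hf2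
  have := tendstoInDistribution_inv_sqrt_mul_sum_sub (X := fun i ω => f (X i ω)) (Y := Y) (P := P)
    (P' := P') (by rwa [hv]) hm (hX_indep.comp (fun _ => f) fun _ => hf)
    (identDistrib_comp hX_law hf)
  simp only [h0, mul_zero, sub_zero] at this
  exact this

/-- The central limit theorem for two functions of independent identically distributed
observations. -/
lemma tendstoInDistribution_normSum_prodMk [IsProbabilityMeasure F] (hX_law : ∀ i, HasLaw (X i) F P)
    (hX_indep : iIndepFun X P) {f g : ℝ → ℝ} (hf : Measurable f) (hf2 : MemLp f 2 F)
    (hf0 : ∫ x, f x ∂F = 0) (hg : Measurable g) (hg2 : MemLp g 2 F) (hg0 : ∫ x, g x ∂F = 0)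
    {a b c d : ℝ} (hff : ∫ x, f x ^ 2 ∂F = a ^ 2 + b ^ 2) (hgg : ∫ x, g x ^ 2 ∂F = c ^ 2 + d ^ 2)
    (hfg : ∫ x, f x * g x ∂F = a * c + b * d) :
    TendstoInDistribution (fun n ω => (normSum X f n ω, normSum X g n ω)) atTop
      (fun z : ℝ × ℝ => (a * z.1 + b * z.2, c * z.1 + d * z.2)) (fun _ => P) gaussianPlane := by
  refine tendstoInDistribution_prodMk_of_linear (aemeasurable_normSum hX_law hf)
    (aemeasurable_normSum hX_law hg) (by fun_prop) (by fun_prop) fun s t => ?_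
  have hi : Integrable f F := hf2.integrable (by norm_num)
  have hi' : Integrable g F := hg2.integrable (by norm_num)
  have hsq : ∫ x, (s * f x + t * g x) ^ 2 ∂F = (s * a + t * c) ^ 2 + (s * b + t * d) ^ 2 := by
    have e : ∀ x, (s * f x + t * g x) ^ 2
        = s ^ 2 * f x ^ 2 + 2 * s * t * (f x * g x) + t ^ 2 * g x ^ 2 := fun x => by ring
    simp_rw [e]
    have i1 := hf2.integrable_sq.const_mul (s ^ 2)
    have i2 : Integrable (fun x => 2 * s * t * (f x * g x)) F :=
      (hf2.integrable_mul hg2).const_mul (2 * s * t)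
    have i3 := hg2.integrable_sq.const_mul (t ^ 2)
    have i12 : Integrable (fun x => s ^ 2 * f x ^ 2 + 2 * s * t * (f x * g x)) F := i1.add i2
    rw [integral_add i12 i3, integral_add i1 i2, integral_const_mul,
      integral_const_mul, integral_const_mul, hff, hgg, hfg]
    ring
  have := tendstoInDistribution_normSum hX_law hX_indep (f := fun x => s * f x + t * g x)
    (by fun_prop) ((hf2.const_mul s).add (hg2.const_mul t))
    (by rw [integral_add (hi.const_mul s) (hi'.const_mul t), integral_const_mul,
          integral_const_mul, hf0, hg0]; simp)
    (P' := gaussianPlane) (Y := fun z => (s * a + t * c) * z.1 + (s * b + t * d) * z.2)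
    ⟨by fun_prop, by rw [map_linear_gaussianPlane, hsq]⟩
  convert this using 1
  · ext n ω
    simp only [normSum, Finset.sum_add_distrib, ← Finset.mul_sum]
    ring
  · ext z
    ring

/-- All ingredients with a constant limit, n^{-1/2} included, are bundled so that Slutsky's theorem
is applied once. -/
lemma tendstoInMeasure_prodMk_sampleMean_comp (hX_law : ∀ i, HasLaw (X i) F P)
    (hX_indep : iIndepFun X P) {ι : Type*} [Fintype ι] {f : ι → ℝ → ℝ}
    (hf : ∀ j, Measurable (f j)) (hfi : ∀ j, Integrable (f j) F) :
    (∀ n : ℕ, AEMeasurable (fun ω => ((√(n : ℝ))⁻¹,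
      fun j => (∑ i ∈ range n, f j (X i ω)) / (n : ℝ))) P) ∧
    TendstoInMeasure P (fun (n : ℕ) ω => ((√(n : ℝ))⁻¹,
      fun j => (∑ i ∈ range n, f j (X i ω)) / (n : ℝ))) atTop
      (fun _ => ((0 : ℝ), fun j => ∫ x, f j x ∂F)) := by
  have hm : ∀ n : ℕ, AEMeasurable (fun ω => ((√(n : ℝ))⁻¹,
      fun j => (∑ i ∈ range n, f j (X i ω)) / (n : ℝ))) P := by
    refine fun n => aemeasurable_const.prodMk (aemeasurable_pi_lambda _ fun j => ?_)
    exact (Finset.aemeasurable_fun_sum _ fun i _ =>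
      (hf j).comp_aemeasurable (hX_law i).aemeasurable).div_const _
  refine ⟨hm, tendstoInMeasure_of_tendsto_ae (fun n => (hm n).aestronglyMeasurable) ?_⟩
  have : ∀ᵐ ω ∂P, ∀ j, Tendsto (fun n : ℕ => (∑ i ∈ range n, f j (X i ω)) / (n : ℝ)) atTop
      (𝓝 (∫ x, f j x ∂F)) := by
    refine ae_all_iff.2 fun j => ?_
    have hint : Integrable (fun ω => f j (X 0 ω)) P := by
      have := hfi j
      rw [← (hX_law 0).map_eq] at this
      exact this.comp_aemeasurable (hX_law 0).aemeasurable
    have h := strong_law_ae_real (fun i ω => f j (X i ω)) hint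
      (fun i i' hii => ((hX_indep.indepFun hii).comp (hf j) (hf j)))
      (identDistrib_comp hX_law (hf j))
    have e : ∫ ω, f j (X 0 ω) ∂P = ∫ x, f j x ∂F :=
      (hX_law 0).integral_comp (hf j).aestronglyMeasurable
    rwa [e] at h
  have hr : Tendsto (fun n : ℕ => (√(n : ℝ))⁻¹) atTop (𝓝 0) :=
    tendsto_inv_atTop_zero.comp (Real.tendsto_sqrt_atTop.comp tendsto_natCast_atTop_atTop)
  filter_upwards [this] with ω hω
  exact hr.prodMk_nhds (tendsto_pi_nhds.2 hω)

end CLT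

/-! ### Algebraic expansion of the sample central moment. -/

/-- The part of order at least two of the expansion of the sample central moment of order `l + 2`
in powers of the sample mean. -/
noncomputable def higherTerms (l : ℕ) (u r : ℝ) (s : ℕ → ℝ) : ℝ :=
  ∑ j ∈ range (l + 1), ((l + 2).choose (j + 2) : ℝ) * (-u) ^ (j + 2) * r ^ j * s (l - j)

lemma sampleCentralMoment_eq_sum {n : ℕ} (hn : n ≠ 0) (l : ℕ) (x : ℕ → ℝ) (c : ℝ) :
    sampleCentralMoment (l + 2) n x =
      (∑ i ∈ range n, (x i - c) ^ (l + 2)) / n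
      - (l + 2 : ℕ) * ((∑ i ∈ range n, (x i - c)) / n)
        * ((∑ i ∈ range n, (x i - c) ^ (l + 1)) / n)
      + higherTerms l ((∑ i ∈ range n, (x i - c)) / n) 1
          (fun j => (∑ i ∈ range n, (x i - c) ^ j) / n) := by
  have hn' : (n : ℝ) ≠ 0 := by exact_mod_cast hn
  set b := (∑ i ∈ range n, (x i - c)) / (n : ℝ) with hb
  have hmean : sampleMean n x = c + b := by
    rw [hb, sampleMean, Finset.sum_sub_distrib]
    simp only [sum_const, card_range, nsmul_eq_mul]
    field_simp
    ring
  have e : ∀ i, (x i - sampleMean n x) ^ (l + 2)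
      = ∑ j ∈ range (l + 2 + 1), (-b) ^ j * (x i - c) ^ (l + 2 - j) * ((l + 2).choose j : ℝ) := by
    intro i
    rw [← add_pow, hmean]
    congr 1
    ring
  rw [sampleCentralMoment]
  simp_rw [e]
  -- The terms of degree 0 and 1 in the sample mean are split off; the rest is `higherTerms`.
  rw [Finset.sum_comm, Finset.sum_div, Finset.sum_range_succ', Finset.sum_range_succ', higherTerms,
    add_assoc, add_comm]
  congr 1
  · simp only [zero_add, pow_one, pow_zero, one_mul, Nat.choose_zero_right, Nat.choose_one_right,
      Nat.cast_one, mul_one, Nat.sub_zero]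
    rw [← Finset.sum_mul, ← Finset.mul_sum, show l + 2 - 1 = l + 1 from rfl]
    ring
  · refine Finset.sum_congr rfl fun j _ => ?_
    rw [← Finset.sum_mul, ← Finset.mul_sum, show l + 2 - (j + 1 + 1) = l - j by omega]
    ring

/-- With q = √n, the term of degree j + 2 in the sample mean keeps a factor n^{-j/2} after
multiplication by n. Recording it in the parameter `r` makes the limit n → ∞ the continuous
substitution r = 0, where only the quadratic term survives. -/
lemma higherTerms_rescale {q : ℝ} (hq : q ≠ 0) (l : ℕ) (t : ℝ) (s : ℕ → ℝ) :
    q ^ 2 * higherTerms l (t / q ^ 2) 1 s = higherTerms l (q⁻¹ * t) q⁻¹ s := by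
  rw [higherTerms, higherTerms, Finset.mul_sum]
  refine Finset.sum_congr rfl fun j _ => ?_
  have : -(t / q ^ 2) = -(q⁻¹ * t) * q⁻¹ := by field_simp
  rw [this, mul_pow, pow_add q⁻¹ j 2]
  field_simp
  simp

lemma higherTerms_zero_left (l : ℕ) (r : ℝ) (s : ℕ → ℝ) : higherTerms l 0 r s = 0 := by
  simp [higherTerms]

lemma higherTerms_zero_right (l : ℕ) (u : ℝ) (s : ℕ → ℝ) :
    higherTerms l u 0 s = (l + 2) * (l + 1) / 2 * u ^ 2 * s l := by
  rw [higherTerms, Finset.sum_range_succ', Finset.sum_eq_zero (fun j _ => by simp)]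
  have h : ((l + 2).choose 2 : ℝ) = (l + 2) * (l + 1) / 2 := by
    rw [Nat.cast_choose_two]
    push_cast
    ring
  simp [h]

lemma higherTerms_congr {l : ℕ} {u r : ℝ} {s s' : ℕ → ℝ} (h : ∀ j ≤ l, s j = s' j) :
    higherTerms l u r s = higherTerms l u r s' :=
  Finset.sum_congr rfl fun j _ => by rw [h _ (Nat.sub_le l j)]

lemma sqrt_mul_sampleCentralMoment_sub (l n : ℕ) (x : ℕ → ℝ) (c m m' : ℝ) :
    √(n : ℝ) * (sampleCentralMoment (l + 2) n x - m) =
      (√(n : ℝ))⁻¹ * ∑ i ∈ range n, ((x i - c) ^ (l + 2) - m - (l + 2 : ℕ) * m' * (x i - c))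
      - (l + 2 : ℕ) * ((√(n : ℝ))⁻¹ * ∑ i ∈ range n, (x i - c))
        * ((∑ i ∈ range n, (x i - c) ^ (l + 1)) / n - m')
      + (√(n : ℝ))⁻¹ * higherTerms l ((√(n : ℝ))⁻¹ * ∑ i ∈ range n, (x i - c)) (√(n : ℝ))⁻¹
          (fun j => (∑ i ∈ range n, (x i - c) ^ j) / n) := by
  obtain rfl | hn := eq_or_ne n 0
  · simp
  have hn' : (0 : ℝ) < n := by positivity
  rw [sampleCentralMoment_eq_sum hn l x c]
  set q := √(n : ℝ) with hq
  have hq0 : 0 < q := Real.sqrt_pos.2 hn'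
  have hnq : (n : ℝ) = q ^ 2 := (Real.sq_sqrt hn'.le).symm
  rw [hnq, ← higherTerms_rescale hq0.ne']
  simp only [Finset.sum_sub_distrib, ← Finset.mul_sum, sum_const, card_range, nsmul_eq_mul, hnq]
  field_simp
  ring

/-- When the leading sum vanishes termwise, the previous expansion can be multiplied by -√n, which
exposes the next order. -/
lemma natCast_mul_sub_sampleCentralMoment (l n : ℕ) (x : ℕ → ℝ) (c m m' : ℝ)
    (h : ∀ i, (x i - c) ^ (l + 2) - m - (l + 2 : ℕ) * m' * (x i - c) = 0) :
    (n : ℝ) * (m - sampleCentralMoment (l + 2) n x) =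
      (l + 2 : ℕ) * ((√(n : ℝ))⁻¹ * ∑ i ∈ range n, (x i - c))
        * ((√(n : ℝ))⁻¹ * ∑ i ∈ range n, ((x i - c) ^ (l + 1) - m'))
      - higherTerms l ((√(n : ℝ))⁻¹ * ∑ i ∈ range n, (x i - c)) (√(n : ℝ))⁻¹
          (fun j => (∑ i ∈ range n, (x i - c) ^ j) / n) := by
  obtain rfl | hn := eq_or_ne n 0
  · simp [higherTerms_zero_left]
  have hn' : (0 : ℝ) < n := by positivity
  have key := sqrt_mul_sampleCentralMoment_sub l n x c m m'
  simp only [h, sum_const_zero, mul_zero, zero_sub] at key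
  set q := √(n : ℝ) with hq
  have hq0 : 0 < q := Real.sqrt_pos.2 hn'
  have hnq : (n : ℝ) = q ^ 2 := (Real.sq_sqrt hn'.le).symm
  have e : (n : ℝ) * (m - sampleCentralMoment (l + 2) n x)
      = - q * (q * (sampleCentralMoment (l + 2) n x - m)) := by rw [hnq]; ring
  rw [e, key]
  simp only [Finset.sum_sub_distrib, sum_const, card_range, nsmul_eq_mul, hnq]
  field_simp
  ring

/-! ### Integrability of centred powers. -/

section Moments

variable {F : Measure ℝ}

lemma mom_eq_integral (F : Measure ℝ) (j : ℕ) : mom F j = ∫ x, (x - ∫ y, y ∂F) ^ j ∂F := rfl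

variable [IsProbabilityMeasure F]

lemma memLp_sub_mean {k : ℕ} (hk : k ≠ 0)
    (hF : Integrable (fun x : ℝ => |x| ^ (2 * k)) F) :
    MemLp (fun x => x - ∫ y, y ∂F) (2 * k : ℕ) F := by
  have h : MemLp (fun x : ℝ => x) (2 * k : ℕ) F := by
    rw [← integrable_norm_rpow_iff (by fun_prop) (by simpa using hk) (ENNReal.natCast_ne_top _)]
    simpa only [ENNReal.toReal_natCast, Real.rpow_natCast, Real.norm_eq_abs] using hF
  exact h.sub (memLp_const _)

lemma memLp_sub_mean_pow {k : ℕ} (hk : k ≠ 0)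
    (hF : Integrable (fun x : ℝ => |x| ^ (2 * k)) F) {j : ℕ} (hj : j ≤ k) :
    MemLp (fun x => (x - ∫ y, y ∂F) ^ j) 2 F := by
  rw [memLp_two_iff_integrable_sq (by fun_prop)]
  have h : MemLp (fun x => x - ∫ y, y ∂F) (2 * j : ℕ) F :=
    (memLp_sub_mean hk hF).mono_exponent (by exact_mod_cast (by omega))
  obtain rfl | hj0 := eq_or_ne j 0
  · simp
  refine (h.integrable_norm_pow (by omega)).congr (ae_of_all _ fun x => ?_)
  simp only [Real.norm_eq_abs]
  rw [← pow_mul, mul_comm j 2, pow_mul, pow_mul, sq_abs]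

lemma integral_sub_mean (h : Integrable (fun x : ℝ => x) F) : ∫ x, (x - ∫ y, y ∂F) ∂F = 0 := by
  rw [integral_sub h (integrable_const _)]
  simp

end Moments

/-! ### Cauchy–Schwarz and the polynomials `defect` and `cofactor`. -/

section Polynomials

variable {F : Measure ℝ}

lemma stdDev_sq (F : Measure ℝ) : stdDev F ^ 2 = mom F 2 :=
  Real.sq_sqrt (integral_nonneg fun _ => sq_nonneg _)

/-- Cholesky factorization of a 2 × 2 covariance matrix; the zeros match the shape required by the
bivariate CLT. -/
lemma exists_sq_add_sq_of_sq_le {x y w : ℝ} (hx : 0 < x) (h : w ^ 2 ≤ x * y) :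
    ∃ a c d : ℝ, x = a ^ 2 + 0 ^ 2 ∧ y = c ^ 2 + d ^ 2 ∧ w = a * c + 0 * d := by
  have hs : √x ≠ 0 := (Real.sqrt_pos.2 hx).ne'
  have hd : 0 ≤ y - w ^ 2 / x := by
    rw [sub_nonneg, div_le_iff₀ hx]
    linarith
  refine ⟨√x, w / √x, √(y - w ^ 2 / x), ?_, ?_, ?_⟩
  · rw [Real.sq_sqrt hx.le]; ring
  · rw [Real.sq_sqrt hd, div_pow, Real.sq_sqrt hx.le]; ring
  · field_simp
    ring

/-- With A = ∫f² and B = ∫fg, the integral of (Ag - Bf)² is A(A∫g² - B²) ≥ 0, and A > 0 can be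
cancelled. -/
lemma sq_integral_mul_le {f g : ℝ → ℝ} (hf : MemLp f 2 F) (hg : MemLp g 2 F)
    (hpos : 0 < ∫ x, f x ^ 2 ∂F) :
    (∫ x, f x * g x ∂F) ^ 2 ≤ (∫ x, f x ^ 2 ∂F) * ∫ x, g x ^ 2 ∂F := by
  set A := ∫ x, f x ^ 2 ∂F
  set B := ∫ x, f x * g x ∂F
  have i1 : Integrable (fun x => A ^ 2 * g x ^ 2) F := hg.integrable_sq.const_mul _
  have i2 : Integrable (fun x => 2 * A * B * (f x * g x)) F :=
    (hf.integrable_mul hg).const_mul (2 * A * B)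
  have i3 : Integrable (fun x => B ^ 2 * f x ^ 2) F := hf.integrable_sq.const_mul _
  have i12 : Integrable (fun x => A ^ 2 * g x ^ 2 - 2 * A * B * (f x * g x)) F := i1.sub i2
  have h : 0 ≤ ∫ x, (A * g x - B * f x) ^ 2 ∂F := integral_nonneg fun x => by positivity
  have e : ∀ x, (A * g x - B * f x) ^ 2
      = A ^ 2 * g x ^ 2 - 2 * A * B * (f x * g x) + B ^ 2 * f x ^ 2 := fun x => by ring
  simp_rw [e] at h
  rw [integral_add i12 i3, integral_sub i1 i2, integral_const_mul, integral_const_mul,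
    integral_const_mul] at h
  change 0 ≤ A ^ 2 * (∫ x, g x ^ 2 ∂F) - 2 * A * B * B + B ^ 2 * A at h
  have h' : 0 ≤ A * (A * (∫ x, g x ^ 2 ∂F) - B ^ 2) := by linarith
  have := nonneg_of_mul_nonneg_right h' hpos
  linarith

/-- The polynomial whose vanishing characterizes singular distributions. -/
noncomputable def defect (F : Measure ℝ) (l : ℕ) (x : ℝ) : ℝ :=
  (x - ∫ y, y ∂F) ^ (l + 2) - mom F (l + 2) - (l + 2 : ℕ) * mom F (l + 1) * (x - ∫ y, y ∂F)

lemma measurable_defect (l : ℕ) : Measurable (defect F l) := by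
  unfold defect
  fun_prop

/-- The centered `(l + 1)`-st power, corrected by a multiple of the centered observation. -/
noncomputable def cofactor (F : Measure ℝ) (l : ℕ) (x : ℝ) : ℝ :=
  (x - ∫ y, y ∂F) ^ (l + 1) - mom F (l + 1) - (l + 1) / 2 * mom F l * (x - ∫ y, y ∂F)

lemma measurable_cofactor (l : ℕ) : Measurable (cofactor F l) := by
  unfold cofactor
  fun_prop

lemma mom_two_pos (hnd : F.support.Nontrivial) (h : MemLp (fun x => x - ∫ y, y ∂F) 2 F) :
    0 < mom F 2 := by
  have h0 : 0 ≤ mom F 2 := integral_nonneg fun _ => sq_nonneg _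
  refine h0.lt_of_ne fun h1 => ?_
  rw [mom_eq_integral, eq_comm, integral_eq_zero_iff_of_nonneg (fun _ => by positivity)
    h.integrable_sq] at h1
  have hsub : F.support ⊆ {∫ y, y ∂F} := by
    refine Measure.support_subset_of_isClosed isClosed_singleton ?_
    filter_upwards [h1] with x hx
    exact sub_eq_zero.1 (pow_eq_zero_iff two_ne_zero |>.1 hx)
  exact Set.not_nontrivial_singleton (hnd.mono hsub)

end Polynomials

/-! ### Vanishing of the defect and the limit as a product of Gaussians. -/

section Limit

variable {Ω : Type*} [MeasurableSpace Ω] {P : Measure Ω} [IsProbabilityMeasure P]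
  {F : Measure ℝ} [IsProbabilityMeasure F] {X : ℕ → Ω → ℝ}

lemma tendstoInDistribution_continuous_normSum_moments (hX_law : ∀ i, HasLaw (X i) F P)
    (hX_indep : iIndepFun X P) {f g : ℝ → ℝ} (hf : Measurable f) (hf2 : MemLp f 2 F)
    (hf0 : ∫ x, f x ∂F = 0) (hg : Measurable g) (hg2 : MemLp g 2 F) (hg0 : ∫ x, g x ∂F = 0)
    {a b c d : ℝ} (hff : ∫ x, f x ^ 2 ∂F = a ^ 2 + b ^ 2) (hgg : ∫ x, g x ^ 2 ∂F = c ^ 2 + d ^ 2)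
    (hfg : ∫ x, f x * g x ∂F = a * c + b * d) {N : ℕ}
    (hm : ∀ j < N, Integrable (fun x => (x - ∫ y, y ∂F) ^ j) F)
    {G : (ℝ × ℝ) × ℝ × (Fin N → ℝ) → ℝ} (hG : Continuous G) :
    TendstoInDistribution (fun (n : ℕ) ω => G ((normSum X f n ω, normSum X g n ω),
        ((√(n : ℝ))⁻¹, fun j => (∑ i ∈ range n, (X i ω - ∫ y, y ∂F) ^ (j : ℕ)) / (n : ℝ)))) atTop
      (fun z : ℝ × ℝ => G ((a * z.1 + b * z.2, c * z.1 + d * z.2), (0, fun j => mom F j)))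
      (fun _ => P) gaussianPlane := by
  have h1 := tendstoInDistribution_normSum_prodMk hX_law hX_indep hf hf2 hf0 hg hg2 hg0 hff hgg hfg
  have h2 := tendstoInMeasure_prodMk_sampleMean_comp hX_law hX_indep
    (f := fun (j : Fin N) x => (x - ∫ y, y ∂F) ^ (j : ℕ)) (fun j => by fun_prop)
    (fun j => hm j j.2)
  exact h1.continuous_comp_prodMk_of_tendstoInMeasure_const hG h2.2 h2.1

lemma IsSingular.memLp {l : ℕ} (hF : IsSingular F (l + 2)) {j : ℕ} (hj : j ≤ l + 2) :
    MemLp (fun x => (x - ∫ y, y ∂F) ^ j) 2 F :=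
  memLp_sub_mean_pow (by omega) hF.integrable hj

lemma IsSingular.integrable_pow {l : ℕ} (hF : IsSingular F (l + 2)) {j : ℕ} (hj : j ≤ l + 2) :
    Integrable (fun x => (x - ∫ y, y ∂F) ^ j) F :=
  (hF.memLp hj).integrable (by norm_num)

lemma IsSingular.memLp_sub {l : ℕ} (hF : IsSingular F (l + 2)) :
    MemLp (fun x => x - ∫ y, y ∂F) 2 F := by
  simpa using hF.memLp (j := 1) (by omega)

lemma IsSingular.integral_sub {l : ℕ} (hF : IsSingular F (l + 2)) :
    ∫ x, (x - ∫ y, y ∂F) ∂F = 0 := by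
  refine integral_sub_mean ?_
  have := (hF.memLp_sub.integrable (by norm_num)).add (integrable_const (∫ y, y ∂F))
  refine this.congr (ae_of_all _ fun x => ?_)
  simp

lemma IsSingular.mom_two_pos {l : ℕ} (hF : IsSingular F (l + 2)) : 0 < mom F 2 :=
  SampleMoments.mom_two_pos hF.nondegenerate hF.memLp_sub

/-- The quantity tending to 0 by singularity also converges to a centred Gaussian with variance ∫
`defect`²; uniqueness of limits makes this variance zero. -/
lemma IsSingular.ae_defect_eq_zero {l : ℕ} (hF : IsSingular F (l + 2)) :
    ∀ᵐ x ∂F, defect F l x = 0 := by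
  have hY2 := hF.memLp_sub
  have hY0 := hF.integral_sub
  have hD2 : MemLp (defect F l) 2 F :=
    ((hF.memLp le_rfl).sub (memLp_const _)).sub (hY2.const_mul _)
  have hD0 : ∫ x, defect F l x ∂F = 0 := by
    have i1 := hF.integrable_pow le_rfl
    have i2 : Integrable (fun _ : ℝ => mom F (l + 2)) F := integrable_const _
    have i3 := (hY2.integrable (by norm_num)).const_mul ((l + 2 : ℕ) * mom F (l + 1))
    have i12 : Integrable (fun x => (x - ∫ y, y ∂F) ^ (l + 2) - mom F (l + 2)) F := i1.sub i2
    simp only [defect]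
    rw [MeasureTheory.integral_sub i12 i3, MeasureTheory.integral_sub i1 i2,
      integral_const_mul, hY0,
      ← mom_eq_integral]
    simp
  obtain ⟨a, c, d, ha, hcd, hacd⟩ := exists_sq_add_sq_of_sq_le hF.mom_two_pos
    (sq_integral_mul_le hY2 hD2 hF.mom_two_pos)
  have hlaw : ∀ i, HasLaw (fun x : ℕ → ℝ => x i) F (Measure.infinitePi fun _ => F) := fun i =>
    (measurePreserving_eval_infinitePi (fun _ : ℕ => F) i).hasLaw
  have hind : iIndepFun (fun (i : ℕ) (x : ℕ → ℝ) => x i) (Measure.infinitePi fun _ => F) :=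
    iIndepFun_infinitePi (X := fun _ x => x) (by fun_prop)
  have key := tendstoInDistribution_continuous_normSum_moments hlaw hind (by fun_prop) hY2 hY0
    (measurable_defect l) hD2 hD0 ha hcd hacd (N := l + 2)
    (fun j hj => hF.integrable_pow hj.le)
    -- `Fin.ofNat` reduces modulo l + 2, which is harmless because only moments of order at most l +
    -- 1 occur.
    (G := fun p => p.1.2 - (l + 2 : ℕ) * p.1.1 * (p.2.2 (Fin.ofNat (l + 2) (l + 1)) - mom F (l + 1))
      + p.2.1 * higherTerms l p.1.1 p.2.1 (fun j => p.2.2 (Fin.ofNat (l + 2) j)))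
    (by unfold higherTerms; fun_prop)
  have hS : TendstoInDistribution
      (fun (n : ℕ) (x : ℕ → ℝ) => √(n : ℝ) * (sampleCentralMoment (l + 2) n x - mom F (l + 2)))
      atTop (fun z : ℝ × ℝ => c * z.1 + d * z.2) (fun _ => Measure.infinitePi fun _ => F)
      gaussianPlane := by
    convert key using 1
    · ext n x
      rw [sqrt_mul_sampleCentralMoment_sub l n x (∫ y, y ∂F) (mom F (l + 2)) (mom F (l + 1))]
      simp only [normSum, defect, Fin.val_ofNat]
      rw [Nat.mod_eq_of_lt (by omega : l + 1 < l + 2)]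
      congr 2
      exact higherTerms_congr fun j hj => by rw [Nat.mod_eq_of_lt (by omega)]
    · ext z
      simp only [Fin.val_ofNat]
      rw [Nat.mod_eq_of_lt (by omega : l + 1 < l + 2)]
      ring
  have h0 := hF.tendsto.tendstoInDistribution hS.forall_aemeasurable
  have hmap := tendstoInDistribution_unique _ hS h0
  rw [map_linear_gaussianPlane, Measure.map_const, measure_univ, one_smul,
    ← gaussianReal_zero_var, gaussianReal_ext_iff] at hmap
  have hz : c ^ 2 + d ^ 2 = 0 :=
    le_antisymm (Real.toNNReal_eq_zero.1 hmap.2) (by positivity)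
  rw [hz, integral_eq_zero_iff_of_nonneg (fun _ => by positivity) hD2.integrable_sq] at hcd
  filter_upwards [hcd] with x hx
  exact pow_eq_zero_iff two_ne_zero |>.1 hx

lemma IsSingular.memLp_cofactor {l : ℕ} (hF : IsSingular F (l + 2)) : MemLp (cofactor F l) 2 F :=
  ((hF.memLp (by omega)).sub (memLp_const _)).sub (hF.memLp_sub.const_mul _)

lemma IsSingular.integral_cofactor {l : ℕ} (hF : IsSingular F (l + 2)) :
    ∫ x, cofactor F l x ∂F = 0 := by
  have i1 := hF.integrable_pow (j := l + 1) (by omega)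
  have i2 : Integrable (fun _ : ℝ => mom F (l + 1)) F := integrable_const _
  have i3 := (hF.memLp_sub.integrable (by norm_num)).const_mul ((l + 1) / 2 * mom F l)
  have i12 : Integrable (fun x => (x - ∫ y, y ∂F) ^ (l + 1) - mom F (l + 1)) F := i1.sub i2
  simp only [cofactor]
  rw [MeasureTheory.integral_sub i12 i3, MeasureTheory.integral_sub i1 i2, integral_const_mul,
    hF.integral_sub, ← mom_eq_integral]
  simp

lemma IsSingular.integral_mul_cofactor {l : ℕ} (hF : IsSingular F (l + 2)) :
    ∫ x, (x - ∫ y, y ∂F) * cofactor F l x ∂F = alpha F (l + 2) := by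
  have e : ∀ x, (x - ∫ y, y ∂F) * cofactor F l x = (x - ∫ y, y ∂F) ^ (l + 2)
      - mom F (l + 1) * (x - ∫ y, y ∂F) - (l + 1) / 2 * mom F l * (x - ∫ y, y ∂F) ^ 2 :=
    fun x => by rw [cofactor]; ring
  have i1 := hF.integrable_pow le_rfl
  have i2 := (hF.memLp_sub.integrable (by norm_num)).const_mul (mom F (l + 1))
  have i3 := (hF.integrable_pow (j := 2) (by omega)).const_mul ((l + 1) / 2 * mom F l)
  have i12 : Integrable (fun x => (x - ∫ y, y ∂F) ^ (l + 2)
      - mom F (l + 1) * (x - ∫ y, y ∂F)) F := i1.sub i2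
  simp_rw [e]
  rw [MeasureTheory.integral_sub i12 i3, MeasureTheory.integral_sub i1 i2, integral_const_mul,
    integral_const_mul, hF.integral_sub, ← mom_eq_integral, ← mom_eq_integral, alpha, stdDev_sq]
  simp only [Nat.add_sub_cancel]
  push_cast
  ring

lemma IsSingular.integral_cofactor_sq {l : ℕ} (hF : IsSingular F (l + 2)) :
    ∫ x, cofactor F l x ^ 2 ∂F = theta F (l + 2) := by
  set κ := ((l : ℝ) + 1) / 2 * mom F l with hκ
  have hY := hF.memLp_sub
  have e : ∀ x, cofactor F l x ^ 2 = ((x - ∫ y, y ∂F) ^ (l + 1)) ^ 2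
      - 2 * mom F (l + 1) * (x - ∫ y, y ∂F) ^ (l + 1) + mom F (l + 1) ^ 2
      - 2 * κ * (x - ∫ y, y ∂F) ^ (l + 2) + 2 * κ * mom F (l + 1) * (x - ∫ y, y ∂F)
      + κ ^ 2 * (x - ∫ y, y ∂F) ^ 2 :=
    fun x => by rw [cofactor]; ring
  have i1 := (hF.memLp (j := l + 1) (by omega)).integrable_sq
  have i2 := (hF.integrable_pow (j := l + 1) (by omega)).const_mul (2 * mom F (l + 1))
  have i3 : Integrable (fun _ : ℝ => mom F (l + 1) ^ 2) F := integrable_const _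
  have i4 := (hF.integrable_pow le_rfl).const_mul (2 * κ)
  have i5 := (hY.integrable (by norm_num)).const_mul (2 * κ * mom F (l + 1))
  have i6 := (hF.integrable_pow (j := 2) (by omega)).const_mul (κ ^ 2)
  have j2 := i1.sub i2
  have j3 := j2.add i3
  have j4 := j3.sub i4
  have j5 := j4.add i5
  have h2 : ∫ x, ((x - ∫ y, y ∂F) ^ (l + 1)) ^ 2 ∂F = mom F (2 * (l + 2) - 2) := by
    rw [mom_eq_integral]
    simp_rw [← pow_mul]
    congr! 3
    omega
  simp_rw [e]
  rw [integral_add (by exact j5) i6, integral_add (by exact j4) i5,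
    MeasureTheory.integral_sub (by exact j3) i4, integral_add (by exact j2) i3,
    MeasureTheory.integral_sub i1 i2]
  simp only [integral_const_mul, hF.integral_sub, h2, ← mom_eq_integral, integral_const,
    probReal_univ, theta, stdDev_sq, show l + 2 - 1 = l + 1 from rfl, Nat.add_sub_cancel]
  push_cast
  rw [hκ]
  simp only [smul_eq_mul]
  ring

/-- The limit of `n (μ_k - M_{k,n})` as the product of two jointly Gaussian variables. -/
lemma IsSingular.tendstoInDistribution_scaledError {l : ℕ} (hF : IsSingular F (l + 2))
    (hX_law : ∀ i, HasLaw (X i) F P) (hX_indep : iIndepFun X P) {a b c d : ℝ}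
    (hff : mom F 2 = a ^ 2 + b ^ 2) (hgg : theta F (l + 2) = c ^ 2 + d ^ 2)
    (hfg : alpha F (l + 2) = a * c + b * d) :
    TendstoInDistribution (scaledError F (l + 2) X) atTop
      (fun z : ℝ × ℝ => (l + 2 : ℕ) * ((a * z.1 + b * z.2) * (c * z.1 + d * z.2)))
      (fun _ => P) gaussianPlane := by
  have key := tendstoInDistribution_continuous_normSum_moments hX_law hX_indep (by fun_prop)
    hF.memLp_sub hF.integral_sub (measurable_cofactor l) hF.memLp_cofactor hF.integral_cofactor
    hff (hF.integral_cofactor_sq.trans hgg) (hF.integral_mul_cofactor.trans hfg) (N := l + 2)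
    (fun j hj => hF.integrable_pow hj.le)
    -- Adding back the linear correction in `cofactor` recovers the sum of (l + 1)-st powers. In the
    -- limit this correction cancels the quadratic part of `higherTerms`, leaving a pure product.
    (G := fun p => (l + 2 : ℕ) * p.1.1 * (p.1.2 + (l + 1) / 2 * mom F l * p.1.1)
      - higherTerms l p.1.1 p.2.1 (fun j => p.2.2 (Fin.ofNat (l + 2) j)))
    (by unfold higherTerms; fun_prop)
  refine key.congr (fun n => ?_) (ae_of_all _ fun z => ?_)
  · have hae : ∀ᵐ ω ∂P, ∀ i, defect F l (X i ω) = 0 := ae_all_iff.2 fun i =>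
      ((hX_law i).ae_iff (measurableSet_setOfPred.1
        (measurableSet_eq_fun (measurable_defect l) measurable_const))).2 hF.ae_defect_eq_zero
    filter_upwards [hae] with ω hω
    rw [scaledError, natCast_mul_sub_sampleCentralMoment l n _ (∫ y, y ∂F) (mom F (l + 2))
      (mom F (l + 1)) hω]
    congr 1
    · simp only [normSum, cofactor, Finset.sum_sub_distrib, ← Finset.mul_sum]
      ring
    · exact higherTerms_congr fun j hj => by
        simp only [Fin.val_ofNat]
        rw [Nat.mod_eq_of_lt (by omega)]
  · simp only [higherTerms_zero_right, Fin.val_ofNat]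
    rw [Nat.mod_eq_of_lt (by omega : l < l + 2)]
    push_cast
    ring

end Limit

/-! ### Chi-square laws and how to tell them apart. -/

section ChiSquare

lemma hasLaw_sq_gaussianReal : HasLaw (fun z : ℝ => z ^ 2) chiSquareOne (gaussianReal 0 1) :=
  ⟨by fun_prop, rfl⟩

instance : IsProbabilityMeasure chiSquareOne :=
  hasLaw_sq_gaussianReal.isProbabilityMeasure_iff.1 inferInstance

lemma memLp_id_chiSquareOne : MemLp id 2 chiSquareOne := by
  rw [chiSquareOne, memLp_map_measure_iff (by fun_prop) (by fun_prop),
    memLp_two_iff_integrable_sq (by fun_prop)]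
  have := (memLp_id_gaussianReal (μ := 0) (v := 1) 4).integrable_norm_pow (p := 4) (by norm_num)
  refine this.congr (ae_of_all _ fun z => ?_)
  simp only [id, Function.comp_apply, Real.norm_eq_abs]
  rw [← pow_mul, Even.pow_abs ⟨2, rfl⟩]

lemma integral_id_chiSquareOne : ∫ x, x ∂chiSquareOne = 1 := by
  rw [← hasLaw_sq_gaussianReal.integral_eq]
  have h := variance_id_gaussianReal (μ := 0) (v := 1)
  rw [variance_of_integral_eq_zero (by fun_prop) (by simp)] at h
  simpa using h

/-- Zero variance would put a standard normal variable in {1, -1} almost surely, which is a null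
set. The exact value of the variance is never needed. -/
lemma variance_id_chiSquareOne_pos : 0 < Var[id; chiSquareOne] := by
  refine (variance_nonneg _ _).lt_of_ne fun h => ?_
  have h1 := ae_eq_integral_of_variance_eq_zero memLp_id_chiSquareOne h.symm
  have h2 : ∀ᵐ z ∂gaussianReal 0 1, z ^ 2 = (1 : ℝ) := by
    refine (hasLaw_sq_gaussianReal.ae_iff (p := fun x => x = 1)
      (measurableSet_setOfPred.1 (measurableSet_eq_fun measurable_id measurable_const))).2 ?_
    filter_upwards [h1] with x hx
    simpa [integral_id_chiSquareOne] using hx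
  have hnull : gaussianReal 0 1 {1, -1} = 0 := by
    have := nullSingletonClass_gaussianReal (μ := 0) (v := 1) one_ne_zero
    exact (Set.toFinite _).measure_zero _
  have h3 : ∀ᵐ z ∂gaussianReal 0 1, z ∉ ({1, -1} : Set ℝ) := measure_eq_zero_iff_ae_notMem.1 hnull
  obtain ⟨z, hz, hz'⟩ := (h2.and h3).exists
  exact hz' (by simpa using hz)

variable {Ω : Type*} [MeasurableSpace Ω] {P : Measure Ω} {C C' : Ω → ℝ}

lemma integral_of_hasLaw_chiSquareOne (hC : HasLaw C chiSquareOne P) : ∫ ω, C ω ∂P = 1 :=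
  hC.integral_eq.trans integral_id_chiSquareOne

lemma memLp_of_hasLaw_chiSquareOne (hC : HasLaw C chiSquareOne P) : MemLp C 2 P := by
  have h := memLp_id_chiSquareOne
  rw [← hC.map_eq] at h
  exact (memLp_map_measure_iff (by fun_prop) hC.aemeasurable).1 h

lemma variance_of_hasLaw_chiSquareOne (hC : HasLaw C chiSquareOne P) :
    Var[C; P] = Var[id; chiSquareOne] := hC.variance_eq

lemma map_sq_gaussianPlane (hC : HasLaw C chiSquareOne P) (a : ℝ) :
    gaussianPlane.map (fun z => a * z.1 ^ 2) = P.map (fun ω => a * C ω) := by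
  have h1 : HasLaw (fun z : ℝ × ℝ => z.1) (gaussianReal 0 1) gaussianPlane := ⟨by fun_prop, by simp⟩
  have h2 : HasLaw (fun x : ℝ => a * x) (chiSquareOne.map fun x => a * x) chiSquareOne :=
    ⟨by fun_prop, rfl⟩
  exact (h2.fun_comp (hasLaw_sq_gaussianReal.fun_comp h1)).map_eq.trans
    (h2.fun_comp hC).map_eq.symm

lemma eq_of_map_mul_eq (hC : HasLaw C chiSquareOne P) {l l' : ℝ}
    (h : P.map (fun ω => l * C ω) = P.map (fun ω => l' * C ω)) : l = l' := by
  have hm := hC.aemeasurable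
  have := congrArg (fun μ : Measure ℝ => ∫ x, x ∂μ) h
  beta_reduce at this
  rw [integral_map (by fun_prop) (by fun_prop), integral_map (by fun_prop) (by fun_prop),
    integral_const_mul, integral_const_mul, integral_of_hasLaw_chiSquareOne hC] at this
  simpa using this

variable [IsProbabilityMeasure P]

/-- Equal means give l = a - b and equal variances give l² = a² + b², so ab = 0. -/
lemma map_mul_ne_map_mul_sub_mul (hC : HasLaw C chiSquareOne P) (hC' : HasLaw C' chiSquareOne P)
    (hCC' : IndepFun C C' P) {l a b : ℝ} (ha : 0 < a) (hb : 0 < b) :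
    P.map (fun ω => l * C ω) ≠ P.map (fun ω => a * C ω - b * C' ω) := by
  intro h
  have hm := hC.aemeasurable
  have hm' := hC'.aemeasurable
  have hL := memLp_of_hasLaw_chiSquareOne hC
  have hL' := memLp_of_hasLaw_chiSquareOne hC'
  have h1 : l = a - b := by
    have := congrArg (fun μ : Measure ℝ => ∫ x, x ∂μ) h
    beta_reduce at this
    rw [integral_map (by fun_prop) (by fun_prop), integral_map (by fun_prop) (by fun_prop),
      integral_sub ((hL.integrable (by norm_num)).const_mul _)
        ((hL'.integrable (by norm_num)).const_mul _), integral_const_mul, integral_const_mul,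
      integral_const_mul, integral_of_hasLaw_chiSquareOne hC,
      integral_of_hasLaw_chiSquareOne hC'] at this
    simpa using this
  have h2 : l ^ 2 * Var[id; chiSquareOne] = (a ^ 2 + b ^ 2) * Var[id; chiSquareOne] := by
    have := congrArg (fun μ : Measure ℝ => Var[id; μ]) h
    beta_reduce at this
    have hind : IndepFun (fun ω => a * C ω) (fun ω => -b * C' ω) P :=
      hCC'.comp (φ := fun x => a * x) (ψ := fun x => -b * x) (by fun_prop) (by fun_prop)
    have e : (fun ω => a * C ω - b * C' ω) = (fun ω => a * C ω) + fun ω => -b * C' ω := by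
      ext ω
      simp only [Pi.add_apply]
      ring
    rw [variance_id_map (by fun_prop), variance_id_map (by fun_prop), variance_const_mul, e,
      hind.variance_add (hL.const_mul a) (hL'.const_mul (-b)),
      variance_const_mul, variance_const_mul, variance_of_hasLaw_chiSquareOne hC,
      variance_of_hasLaw_chiSquareOne hC'] at this
    rw [this]
    ring
  have h3 := mul_right_cancel₀ variance_id_chiSquareOne_pos.ne' h2
  rw [h1] at h3
  nlinarith [mul_pos ha hb]

lemma map_sq_sub_sq_gaussianPlane (hC : HasLaw C chiSquareOne P) (hC' : HasLaw C' chiSquareOne P)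
    (hCC' : IndepFun C C' P) (a b : ℝ) :
    gaussianPlane.map (fun z => a * z.1 ^ 2 - b * z.2 ^ 2)
      = P.map (fun ω => a * C ω - b * C' ω) := by
  have h1 : HasLaw (fun z : ℝ × ℝ => (z.1 ^ 2, z.2 ^ 2)) (chiSquareOne.prod chiSquareOne)
      gaussianPlane :=
    ⟨by fun_prop, (Measure.map_prod_map (f := fun x : ℝ => x ^ 2) (g := fun x : ℝ => x ^ 2) _ _
      (by fun_prop) (by fun_prop)).symm⟩
  have h2 : HasLaw (fun ω => (C ω, C' ω)) (chiSquareOne.prod chiSquareOne) P :=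
    ⟨hC.aemeasurable.prodMk hC'.aemeasurable, by
      rw [hCC'.map_prod_eq_prod_map_map hC.aemeasurable hC'.aemeasurable, hC.map_eq, hC'.map_eq]⟩
  have h3 : HasLaw (fun x : ℝ × ℝ => a * x.1 - b * x.2)
      ((chiSquareOne.prod chiSquareOne).map fun x => a * x.1 - b * x.2)
      (chiSquareOne.prod chiSquareOne) := ⟨by fun_prop, rfl⟩
  exact (h3.fun_comp h1).map_eq.trans (h3.fun_comp h2).map_eq.symm

end ChiSquare

/-! ### The two cases of the dichotomy. -/

section Cases

variable {F : Measure ℝ} {l : ℕ}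

/-- Expanding α_k² and σ²θ_k produces the same terms in μ_{k-2}, which cancel. -/
lemma singleChiRelation_iff : SingleChiRelation F (l + 2) ↔
    alpha F (l + 2) ^ 2 = mom F 2 * theta F (l + 2) := by
  rw [SingleChiRelation, alpha, theta, stdDev_sq]
  constructor <;> intro h <;> linear_combination h

variable [IsProbabilityMeasure F]

lemma IsSingular.stdDev_pos (hF : IsSingular F (l + 2)) : 0 < stdDev F :=
  Real.sqrt_pos.2 hF.mom_two_pos

lemma IsSingular.alpha_sq_le (hF : IsSingular F (l + 2)) :
    alpha F (l + 2) ^ 2 ≤ mom F 2 * theta F (l + 2) := by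
  have := sq_integral_mul_le hF.memLp_sub hF.memLp_cofactor hF.mom_two_pos
  rwa [hF.integral_mul_cofactor, hF.integral_cofactor_sq] at this

lemma IsSingular.theta_pos (hF : IsSingular F (l + 2)) (h : ¬ SingleChiRelation F (l + 2)) :
    0 < theta F (l + 2) := by
  have h1 := hF.alpha_sq_le.lt_of_ne (mt singleChiRelation_iff.2 h)
  exact pos_of_mul_pos_right ((sq_nonneg _).trans_lt h1) hF.mom_two_pos.le

lemma IsSingular.abs_alpha_lt (hF : IsSingular F (l + 2)) (h : ¬ SingleChiRelation F (l + 2)) :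
    |alpha F (l + 2)| < stdDev F * √(theta F (l + 2)) := by
  have h1 := hF.alpha_sq_le.lt_of_ne (mt singleChiRelation_iff.2 h)
  refine abs_lt_of_sq_lt_sq ?_ (mul_nonneg hF.stdDev_pos.le (Real.sqrt_nonneg _))
  rwa [mul_pow, stdDev_sq, Real.sq_sqrt (hF.theta_pos h).le]

lemma IsSingular.lambda_pos (hF : IsSingular F (l + 2)) (h : ¬ SingleChiRelation F (l + 2)) :
    0 < lambdaPos F (l + 2) ∧ 0 < lambdaNeg F (l + 2) := by
  have := abs_lt.1 (hF.abs_alpha_lt h)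
  refine ⟨mul_pos (by positivity) (by linarith), mul_pos (by positivity) (by linarith)⟩

variable {Ω Ω' : Type*} [MeasurableSpace Ω] [MeasurableSpace Ω'] {P : Measure Ω}
  [IsProbabilityMeasure P] {P' : Measure Ω'} [IsProbabilityMeasure P'] {X : ℕ → Ω → ℝ}
  {C C' : Ω' → ℝ}

lemma IsSingular.tendstoInDistribution_of_relation (hF : IsSingular F (l + 2))
    (h : SingleChiRelation F (l + 2)) (hX_law : ∀ i, HasLaw (X i) F P) (hX_indep : iIndepFun X P)
    (hC : HasLaw C chiSquareOne P') :
    TendstoInDistribution (scaledError F (l + 2) X) atTop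
      (fun ω => ((l + 2 : ℕ) * alpha F (l + 2)) * C ω) (fun _ => P) P' := by
  have hm := hC.aemeasurable
  have hσ := hF.stdDev_pos.ne'
  -- Equality in Cauchy–Schwarz allows both Gaussians to be multiples of one coordinate.
  have key := hF.tendstoInDistribution_scaledError hX_law hX_indep (a := stdDev F) (b := 0)
    (c := alpha F (l + 2) / stdDev F) (d := 0) (by rw [stdDev_sq]; ring)
    (by
      rw [div_pow, stdDev_sq, singleChiRelation_iff.1 h]
      field_simp [hF.mom_two_pos.ne']
      ring)
    (by field_simp; ring)
  refine TendstoInDistribution.congr_map key (by fun_prop) ?_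
  rw [← map_sq_gaussianPlane hC]
  congr 1
  ext z
  field_simp
  ring

lemma IsSingular.tendstoInDistribution_of_not_relation (hF : IsSingular F (l + 2))
    (h : ¬ SingleChiRelation F (l + 2)) (hX_law : ∀ i, HasLaw (X i) F P)
    (hX_indep : iIndepFun X P) (hC : HasLaw C chiSquareOne P') (hC' : HasLaw C' chiSquareOne P')
    (hCC' : IndepFun C C' P') :
    TendstoInDistribution (scaledError F (l + 2) X) atTop
      (fun ω => lambdaPos F (l + 2) * C ω - lambdaNeg F (l + 2) * C' ω) (fun _ => P) P' := by
  have hm := hC.aemeasurable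
  have hm' := hC'.aemeasurable
  set σ := stdDev F with hσdef
  set τ := √(theta F (l + 2)) with hτdef
  set α := alpha F (l + 2) with hαdef
  have hσ : 0 < σ := hF.stdDev_pos
  have hτ : 0 < τ := Real.sqrt_pos.2 (hF.theta_pos h)
  have hτ2 : theta F (l + 2) = τ ^ 2 := (Real.sq_sqrt (hF.theta_pos h).le).symm
  have hα := abs_lt.1 (hF.abs_alpha_lt h)
  have hp : 0 ≤ σ * (σ * τ + α) / (2 * τ) :=
    div_nonneg (mul_nonneg hσ.le (by linarith)) (by linarith)
  have hq : 0 ≤ σ * (σ * τ - α) / (2 * τ) :=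
    div_nonneg (mul_nonneg hσ.le (by linarith)) (by linarith)
  set p := √(σ * (σ * τ + α) / (2 * τ))
  set q := √(σ * (σ * τ - α) / (2 * τ))
  have hp2 : p ^ 2 = σ * (σ * τ + α) / (2 * τ) := Real.sq_sqrt hp
  have hq2 : q ^ 2 = σ * (σ * τ - α) / (2 * τ) := Real.sq_sqrt hq
  -- With S = pz₁ + qz₂ and V = (τ/σ)(pz₁ - qz₂) the product has no cross term. The values of p² and
  -- q² solve p² + q² = σ² and (τ/σ)(p² - q²) = α.
  have key := hF.tendstoInDistribution_scaledError hX_law hX_indep (a := p) (b := q)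
    (c := τ / σ * p) (d := -(τ / σ * q))
    (by rw [hp2, hq2, ← stdDev_sq, ← hσdef]; field_simp; ring)
    (by rw [hτ2, neg_sq, mul_pow, mul_pow, hp2, hq2]; field_simp; ring)
    (by
      rw [← hαdef, show p * (τ / σ * p) + q * -(τ / σ * q) = τ / σ * (p ^ 2 - q ^ 2) by ring, hp2,
        hq2]
      field_simp
      ring)
  refine TendstoInDistribution.congr_map key (by fun_prop) ?_
  rw [← map_sq_sub_sq_gaussianPlane hC hC' hCC']
  congr 1
  ext z
  rw [lambdaPos, lambdaNeg, ← hσdef, ← hτdef, ← hαdef,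
    show (p * z.1 + q * z.2) * (τ / σ * p * z.1 + -(τ / σ * q) * z.2)
      = τ / σ * (p ^ 2 * z.1 ^ 2 - q ^ 2 * z.2 ^ 2) by ring, hp2, hq2]
  field_simp

end Cases

end SampleMoments

/-- Let `F` be singular of order `k ≥ 2`, let `X 0, X 1, …` be independent with law `F`, and let
`C`, `C'` be independent with the chi-square law with one degree of freedom. -/
theorem mainTheorem3
    {Ω Ω' : Type*} [MeasurableSpace Ω] [MeasurableSpace Ω']
    (P : Measure Ω) [IsProbabilityMeasure P] (P' : Measure Ω') [IsProbabilityMeasure P']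
    (F : Measure ℝ) [IsProbabilityMeasure F] (k : ℕ) (hk : 2 ≤ k)
    (hF : SampleMoments.IsSingular F k)
    (X : ℕ → Ω → ℝ) (hX_law : ∀ i, HasLaw (X i) F P) (hX_indep : iIndepFun X P)
    (C C' : Ω' → ℝ)
    (hC : HasLaw C SampleMoments.chiSquareOne P') (hC' : HasLaw C' SampleMoments.chiSquareOne P')
    (hCC' : IndepFun C C' P') :
    ((∃ l : ℝ, TendstoInDistribution (SampleMoments.scaledError F k X) atTop
        (fun ω => l * C ω) (fun _ => P) P') ↔ SampleMoments.SingleChiRelation F k) ∧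
    (SampleMoments.SingleChiRelation F k →
      ∀ l : ℝ, TendstoInDistribution (SampleMoments.scaledError F k X) atTop
          (fun ω => l * C ω) (fun _ => P) P' ↔
        l = k * (SampleMoments.mom F k
          - 1 / 2 * ((k : ℝ) - 1) * SampleMoments.stdDev F ^ 2 * SampleMoments.mom F (k - 2))) ∧
    (¬ SampleMoments.SingleChiRelation F k →
      0 < SampleMoments.lambdaPos F k ∧ 0 < SampleMoments.lambdaNeg F k ∧
      TendstoInDistribution (SampleMoments.scaledError F k X) atTop
        (fun ω => SampleMoments.lambdaPos F k * C ω - SampleMoments.lambdaNeg F k * C' ω)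
        (fun _ => P) P') := by
  obtain ⟨l, rfl⟩ : ∃ l, k = l + 2 := ⟨k - 2, by omega⟩
  have hrel : SampleMoments.SingleChiRelation F (l + 2) →
      ∀ c : ℝ, TendstoInDistribution (SampleMoments.scaledError F (l + 2) X) atTop
          (fun ω => c * C ω) (fun _ => P) P' ↔
        c = (l + 2 : ℕ) * SampleMoments.alpha F (l + 2) := by
    intro h c
    have key := hF.tendstoInDistribution_of_relation h hX_law hX_indep hC
    refine ⟨fun hc => ?_, fun hc => hc ▸ key⟩
    exact SampleMoments.eq_of_map_mul_eq hC (tendstoInDistribution_unique _ hc key)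
  refine ⟨⟨fun ⟨c, hc⟩ => ?_, fun h => ⟨_, (hrel h _).2 rfl⟩⟩, hrel, fun h => ?_⟩
  · by_contra h
    obtain ⟨ha, hb⟩ := hF.lambda_pos h
    exact SampleMoments.map_mul_ne_map_mul_sub_mul hC hC' hCC' ha hb (tendstoInDistribution_unique _
      hc (hF.tendstoInDistribution_of_not_relation h hX_law hX_indep hC hC' hCC'))
  · obtain ⟨ha, hb⟩ := hF.lambda_pos h
    exact ⟨ha, hb, hF.tendstoInDistribution_of_not_relation h hX_law hX_indep hC hC' hCC'⟩
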